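/- Let $d\ge 0$ and consider one of two settings: either $\Omega=\mathbb R^d$ with its Euclidean topology and $\nu$ is Lebesgue measure, or $\Omega\subseteq\mathbb R^d$ is countable, carries the discrete topology, and $\nu$ is the counting measure on $\Omega$. Let $\mathcal P(\Omega)$ be the set of probability measures on $\Omega$ that are absolutely continuous with respect to $\nu$. For $P\in\mathcal P(\Omega)$ let $\Omega_P$ be its support, i.e. the smallest closed measurable $A\subseteq\Omega$ with $P(\Omega\setminus A)=0$ (so for countable $\Omega$ it is the set of points of positive mass, $\Omega_P=\{x\in\Omega: P(\{x\})>0\}$), let $\Omega_P^{cc}=\operatorname{cl}(\operatorname{conv}\Omega_P)$ be its convex support (closure in $\mathbb R^d$), and put $$\Theta_P=\Big\{\theta\in\mathbb R^d:\int_\Omega e^{\langle x,\theta\rangle}\,dP(x)<\infty\Big\},\qquad \psi_P(\theta)=\log\int_\Omega e^{\langle x,\theta\rangle}\,dP(x)\ (\theta\in\Theta_P),\quad \psi_P=+\infty\ \text{off } \Theta_P .$$ The MEM function of $P$ is $$\kappa_P(y)=\inf\{\mathrm{KL}(Q\,\|\,P): Q\in\mathcal P(\Omega),\ \mathbb E_Q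 \text{ exists and equals } y\},\qquad \inf\emptyset=+\infty,$$ and $\operatorname{dom}\kappa_P=\{y\in\mathbb R^d:\kappa_P(y)<\infty\}$. Assume that $P\in\mathcal P(\Omega)$ generates a minimal exponential family ($\operatorname{int}\Theta_P\ne\emptyset$ and $\operatorname{int}\Omega_P^{cc}\neq\emptyset$) which is steep (that is, $\psi_P$ is essentially smooth: $\psi_P$ is differentiable on $\operatorname{int}\Theta_P\neq\emptyset$, and $\|\nabla\psi_P(\theta_k)\|\to\infty$ for every sequence $(\theta_k)$ in $\operatorname{int}\Theta_P$ that converges to a boundary point of $\Theta_P$), and that $0\in\operatorname{int}\Theta_P$. Then: (a) If $\Omega_P$ is countable, then $\operatorname{dom}\kappa_P=\operatorname{conv}\Omega_P$. Hence, if $\Omega_P$ is finite, then $\operatorname{dom}\kappa_P=\Omega_P^{cc}$. (b) If $\Omega_P$ is uncountable, then $\operatorname{dom}\kappa_P=\operatorname{int}\Omega_P^{cc}$. -/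

import Mathlib

open MeasureTheory Set Filter
open scoped Topology ENNReal

namespace MEM

/-- `ℝ^d` with its Euclidean structure. -/
abbrev E (d : ℕ) : Type := EuclideanSpace ℝ (Fin d)

/-- The two admissible sample spaces: `Ω = ℝ^d` (dominated by Lebesgue measure), or a countable
set `Ω ⊆ ℝ^d` (dominated by counting measure). -/
inductive SampleSpace (d : ℕ) : Type
  | continuous : SampleSpace d
  | discrete (Ω : Set (E d)) (hΩ : Ω.Countable) : SampleSpace d

variable {d : ℕ}

namespace SampleSpace

/-- The underlying set `Ω ⊆ ℝ^d`. -/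
def carrier : SampleSpace d → Set (E d)
  | continuous => univ
  | discrete Ω _ => Ω

/-- The dominating measure `ν`; a measure on `Ω` is identified with the measure on `ℝ^d` that
gives no mass to the complement of `Ω`. -/
noncomputable def dominating : SampleSpace d → Measure (E d)
  | continuous => volume
  | discrete Ω _ => Measure.count.restrict Ω

/-- `𝒫(Ω)`: the probability measures absolutely continuous with respect to `ν`. -/
def probMeasures (S : SampleSpace d) : Set (Measure (E d)) :=
  {Q | IsProbabilityMeasure Q ∧ Q ≪ S.dominating}

/-- The closed subsets of `Ω`: for `Ω = ℝ^d` those of the Euclidean topology; a countable `Ω`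
carries the discrete topology, so that all its subsets are closed. -/
def IsClosedIn : SampleSpace d → Set (E d) → Prop
  | continuous, A => IsClosed A
  | discrete Ω _, A => A ⊆ Ω

/-- The support `Ω_P`, that is, the smallest closed measurable `A ⊆ Ω` with `P (Ω \ A) = 0`
(see `isLeast_supp`). For countable `Ω` it is the set of points of positive mass. -/
def supp : SampleSpace d → Measure (E d) → Set (E d)
  | continuous, P => P.support
  | discrete Ω _, P => {x | x ∈ Ω ∧ 0 < P {x}}

theorem isLeast_supp (S : SampleSpace d) (P : Measure (E d)) :
    IsLeast {A | S.IsClosedIn A ∧ MeasurableSet A ∧ P (S.carrier \ A) = 0} (S.supp P) := by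
  cases S with
  | continuous =>
    refine ⟨⟨P.isClosed_support, P.isClosed_support.measurableSet, ?_⟩, ?_⟩
    · change P (univ \ P.support) = 0
      rw [← compl_eq_univ_sdiff]
      exact P.measure_compl_support
    · rintro A ⟨hA, -, h0⟩
      refine Measure.support_subset_of_isClosed hA ?_
      rw [mem_ae_iff, compl_eq_univ_sdiff]
      exact h0
  | discrete Ω hΩ =>
    have hs : {x | x ∈ Ω ∧ 0 < P {x}} ⊆ Ω := fun x hx => hx.1
    refine ⟨⟨hs, (hΩ.mono hs).measurableSet, ?_⟩, ?_⟩
    · change P (Ω \ {x | x ∈ Ω ∧ 0 < P {x}}) = 0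
      have hc : (Ω \ {x | x ∈ Ω ∧ 0 < P {x}}).Countable := hΩ.mono sdiff_subset
      rw [← biUnion_of_singleton (Ω \ {x | x ∈ Ω ∧ 0 < P {x}}), measure_biUnion_null_iff hc]
      rintro x ⟨hx, hn⟩
      by_contra h
      exact hn ⟨hx, pos_iff_ne_zero.mpr h⟩
    · rintro A ⟨-, -, h0⟩ x ⟨hx, hp⟩
      by_contra hA
      have hle : P {x} ≤ P (Ω \ A) := measure_mono (singleton_subset_iff.mpr ⟨hx, hA⟩)
      exact absurd (hle.trans_eq h0) (not_le.mpr hp)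

/-- The convex support `Ω_P^cc = cl (conv Ω_P)`. -/
def convexSupport (S : SampleSpace d) (P : Measure (E d)) : Set (E d) :=
  closure (convexHull ℝ (S.supp P))

end SampleSpace

/-- The effective domain of an extended-real-valued function. -/
def effDom {X R : Type*} [LT R] [Top R] (f : X → R) : Set X := {x | f x < ⊤}

/-- The natural parameter space `Θ_P = {θ : ∫ exp ⟨x, θ⟩ dP(x) < ∞}`. -/
def naturalParams (P : Measure (E d)) : Set (E d) :=
  {θ | Integrable (fun x : E d => Real.exp (inner ℝ x θ)) P}

open Classical in
/-- The log-normalizer `ψ_P`. -/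
noncomputable def logNormalizer (P : Measure (E d)) (θ : E d) : EReal :=
  if θ ∈ naturalParams P then ((Real.log (∫ x, Real.exp (inner ℝ x θ) ∂P) : ℝ) : EReal) else ⊤

/-- The gradient of `ψ` at points of the interior of its domain, where `ψ` is finite. -/
noncomputable def grad (ψ : E d → EReal) (x : E d) : E d :=
  gradient (fun z => (ψ z).toReal) x

/-- Essential smoothness of a proper convex function `ψ` (log-normalizers of probability measures
are always proper and convex). -/
structure EssentiallySmooth (ψ : E d → EReal) : Prop where
  nonempty : (interior (effDom ψ)).Nonempty
  differentiable : ∀ x ∈ interior (effDom ψ), DifferentiableAt ℝ (fun z => (ψ z).toReal) x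
  steep : ∀ (x : ℕ → E d) (a : E d), (∀ k, x k ∈ interior (effDom ψ)) →
    a ∈ frontier (effDom ψ) → Tendsto x atTop (𝓝 a) →
    Tendsto (fun k => ‖grad ψ (x k)‖) atTop atTop

/-- The exponential family generated by `P` is minimal: both the natural parameter space and the
convex support are of full dimension `d`. -/
structure IsMinimal (S : SampleSpace d) (P : Measure (E d)) : Prop where
  params : (interior (naturalParams P)).Nonempty
  convexSupport : (interior (S.convexSupport P)).Nonempty

/-- `P ∈ 𝒫(Ω)` generates a minimal and steep exponential family and `0 ∈ int Θ_P`. -/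
structure IsReference (S : SampleSpace d) (P : Measure (E d)) : Prop where
  mem : P ∈ S.probMeasures
  minimal : IsMinimal S P
  steep : EssentiallySmooth (logNormalizer P)
  zero_mem : (0 : E d) ∈ interior (naturalParams P)

/-- The expected value of `Q` exists and equals `y`. -/
def HasMean (Q : Measure (E d)) (y : E d) : Prop :=
  Integrable (fun x : E d => x) Q ∧ ∫ x, x ∂Q = y

/-- The MEM function `κ_P(y) = inf {KL(Q ‖ P) : Q ∈ 𝒫(Ω), E_Q = y}`, with `inf ∅ = ∞`. -/
noncomputable def mem (S : SampleSpace d) (P : Measure (E d)) (y : E d) : ℝ≥0∞ :=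
  ⨅ Q ∈ {Q : Measure (E d) | Q ∈ S.probMeasures ∧ HasMean Q y}, InformationTheory.klDiv Q P

end MEM

/-! Finite KL divergence forces Q ≪ P, so Q lives on the support of P. A mean never leaves a convex
set carrying the measure, closed or not (`mean_mem_of_convex`). If Q is also absolutely continuous
with respect to Lebesgue measure, its mean is interior, because the frontier of a convex set is
null. Conversely, a bounded density gives finite divergence, and the means of such Q form a convex
set `boundedMeans P`. Conditioning P on an atom puts that atom in the set; conditioning on small
balls makes the set accumulate at every support point. A convex set contains the interior of its
closure, which settles the Lebesgue case. -/

open InformationTheory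
open scoped NNReal

namespace MEM

section Convexity

variable {V : Type*} [NormedAddCommGroup V] [NormedSpace ℝ V] [FiniteDimensional ℝ V]

/-- In finite dimension, a point outside a nonempty convex set can be weakly separated from it by
a nonzero functional, whether or not the set has interior points. -/
theorem exists_ne_zero_forall_le_of_notMem {C : Set V} (hC : Convex ℝ C) (hne : C.Nonempty)
    {y : V} (hy : y ∉ C) : ∃ f : StrongDual ℝ V, f ≠ 0 ∧ ∀ x ∈ C, f x ≤ f y := by
  by_cases hspan : affineSpan ℝ C = ⊤
  · exact geometric_hahn_banach_of_nonempty_interior_point hC (fun h => hy (interior_subset h))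
      (hC.interior_nonempty_iff_affineSpan_eq_top.mpr hspan)
  -- Here `C` lies in a level set of some nonzero `f`; the sign of `f` is then chosen to suit `y`.
  · obtain ⟨a, ha⟩ := hne
    have hdir : (affineSpan ℝ C).direction < ⊤ := by
      rw [lt_top_iff_ne_top, Ne, AffineSubspace.direction_eq_top_iff_of_nonempty
        ⟨a, subset_affineSpan ℝ C ha⟩]
      exact hspan
    obtain ⟨f, hf0, hf⟩ := Submodule.exists_le_ker_of_lt_top _ hdir
    have hconst : ∀ x ∈ C, f x = f a := fun x hx => by
      have h := hf (AffineSubspace.vsub_mem_direction (subset_affineSpan ℝ C hx)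
        (subset_affineSpan ℝ C ha))
      rw [LinearMap.mem_ker, vsub_eq_sub, map_sub] at h
      linarith
    have hg0 : LinearMap.toContinuousLinearMap f ≠ 0 := by simpa using hf0
    rcases le_total (f a) (f y) with h | h
    · exact ⟨LinearMap.toContinuousLinearMap f, hg0, fun x hx => by simpa [hconst x hx] using h⟩
    · exact ⟨-LinearMap.toContinuousLinearMap f, neg_ne_zero.mpr hg0,
        fun x hx => by simpa [hconst x hx] using h⟩

/-- Passing to the closure does not enlarge the interior of a convex set in finite dimension. -/
theorem interior_closure_subset_of_convex {C : Set V} (hC : Convex ℝ C) :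
    interior (closure C) ⊆ C := by
  intro y hy
  -- The affine span is closed, so it contains `closure C`, which is full-dimensional.
  have hspan : affineSpan ℝ C = ⊤ := by
    have h := hC.closure.interior_nonempty_iff_affineSpan_eq_top.mp ⟨y, hy⟩
    rw [eq_top_iff, ← h, affineSpan_le]
    exact closure_minimal (subset_affineSpan ℝ C) (affineSpan ℝ C).closed_of_finiteDimensional
  rw [hC.interior_closure_eq_interior_of_nonempty_interior
    (hC.interior_nonempty_iff_affineSpan_eq_top.mpr hspan)] at hy
  exact interior_subset hy

variable [MeasurableSpace V] {Q : Measure V} [IsProbabilityMeasure Q] {y : V}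

/-- If a functional is almost surely at most its value at the mean, it is almost surely constant. -/
theorem ae_eq_apply_mean (hint : Integrable (fun x : V => x) Q) (hmean : ∫ x, x ∂Q = y)
    (f : StrongDual ℝ V) (hle : ∀ᵐ x ∂Q, f x ≤ f y) : ∀ᵐ x ∂Q, f x = f y := by
  have hfi : Integrable (fun x => f x) Q := f.integrable_comp hint
  have hint' : Integrable (fun x => f y - f x) Q := (integrable_const _).sub hfi
  have h0 : ∫ x, (f y - f x) ∂Q = 0 := by
    rw [integral_sub (integrable_const _) hfi, f.integral_comp_comm hint, hmean]
    simp
  have hnn : 0 ≤ᵐ[Q] fun x => f y - f x := by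
    filter_upwards [hle] with x hx using sub_nonneg.mpr hx
  filter_upwards [(integral_eq_zero_iff_of_nonneg_ae hnn hint').mp h0] with x hx
  exact (sub_eq_zero.mp hx).symm

/-- Induction on the dimension of a direction space `W` with Q carried by `y + W`. If `y ∉ C`, a
separating functional on `W` is almost surely constant, so Q is carried by the translate of a
smaller subspace. -/
theorem mean_mem_of_ae_mem_submodule (hint : Integrable (fun x : V => x) Q)
    (hmean : ∫ x, x ∂Q = y) {C : Set V} (hC : Convex ℝ C) (hQC : ∀ᵐ x ∂Q, x ∈ C) (n : ℕ) :
    ∀ W : Submodule ℝ V, Module.finrank ℝ W = n → (∀ᵐ x ∂Q, x - y ∈ W) → y ∈ C := by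
  induction n using Nat.strong_induction_on with
  | _ n ih =>
    intro W hn hW
    by_contra hy
    have hD : Convex ℝ {w : W | y + (w : V) ∈ C} := by
      have h := (hC.translate_preimage_right y).linear_preimage W.subtype
      exact h
    have hDne : {w : W | y + (w : V) ∈ C}.Nonempty := by
      obtain ⟨x, hx, hxW⟩ := (hQC.and hW).exists
      exact ⟨⟨x - y, hxW⟩, by simpa using hx⟩
    have h0 : (0 : W) ∉ {w : W | y + (w : V) ∈ C} := by simpa using hy
    obtain ⟨f, hf0, hf⟩ := exists_ne_zero_forall_le_of_notMem hD hDne h0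
    obtain ⟨g, hg⟩ := LinearMap.exists_extend (f : W →ₗ[ℝ] ℝ)
    have hgf : ∀ w : W, g w = f w := fun w => LinearMap.congr_fun hg w
    have hle : ∀ᵐ x ∂Q, LinearMap.toContinuousLinearMap g x
        ≤ LinearMap.toContinuousLinearMap g y := by
      filter_upwards [hQC, hW] with x hx hxW
      have h1 := hf ⟨x - y, hxW⟩ (by simpa using hx)
      rw [map_zero, ← hgf, map_sub] at h1
      exact sub_nonpos.mp h1
    have heq := ae_eq_apply_mean hint hmean _ hle
    have hlt : W ⊓ LinearMap.ker g < W := by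
      refine lt_of_le_of_ne inf_le_left fun h => hf0 ?_
      ext w
      rw [← hgf]
      exact (inf_eq_left.mp h) w.2
    refine hy (ih _ (hn ▸ Submodule.finrank_lt_finrank_of_lt hlt) _ rfl ?_)
    filter_upwards [hW, heq] with x hxW hx
    refine ⟨hxW, ?_⟩
    rw [SetLike.mem_coe, LinearMap.mem_ker, map_sub]
    exact sub_eq_zero.mpr hx

/-- The mean of a probability measure concentrated on a convex set belongs to that set, which
need not be closed. -/
theorem mean_mem_of_convex (hint : Integrable (fun x : V => x) Q)
    (hmean : ∫ x, x ∂Q = y) {C : Set V} (hC : Convex ℝ C) (hQC : ∀ᵐ x ∂Q, x ∈ C) : y ∈ C :=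
  mean_mem_of_ae_mem_submodule hint hmean hC hQC _ ⊤ rfl (by simp)

/-- The mean of an absolutely continuous probability measure concentrated on a convex set is an
interior point of that set. -/
theorem mean_mem_interior_of_convex [BorelSpace V] {μ : Measure V} [μ.IsAddHaarMeasure]
    (hQμ : Q ≪ μ) (hint : Integrable (fun x : V => x) Q) (hmean : ∫ x, x ∂Q = y) {C : Set V}
    (hC : Convex ℝ C) (hQC : ∀ᵐ x ∂Q, x ∈ C) : y ∈ interior C := by
  have hint' : ∀ᵐ x ∂Q, x ∈ interior C := by
    have hfr : Q (frontier C) = 0 := hQμ (hC.addHaar_frontier μ)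
    filter_upwards [hQC, measure_eq_zero_iff_ae_notMem.mp hfr] with x hx hxf
    by_contra hxi
    exact hxf ⟨subset_closure hx, hxi⟩
  exact mean_mem_of_convex hint hmean hC.interior hint'

end Convexity

/-- The density takes values in `[0, c]` almost everywhere, and `klFun` is bounded on that compact
interval. -/
theorem klDiv_ne_top_of_le_smul {α : Type*} [MeasurableSpace α] {Q P : Measure α}
    [IsFiniteMeasure Q] [IsFiniteMeasure P] {c : ℝ≥0} (h : Q ≤ c • P) : klDiv Q P ≠ ⊤ := by
  have hac : Q ≪ P := (Measure.absolutelyContinuous_of_le h).trans Measure.smul_absolutelyContinuous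
  refine klDiv_ne_top hac ((integrable_klFun_rnDeriv_iff hac).mp ?_)
  have hbound : ∀ᵐ x ∂P, Q.rnDeriv P x ≤ c := by
    refine ae_le_of_forall_setLIntegral_le_of_sigmaFinite (Q.measurable_rnDeriv P) fun s _ _ => ?_
    calc ∫⁻ x in s, Q.rnDeriv P x ∂P ≤ Q s := Measure.setLIntegral_rnDeriv_le s
      _ ≤ (c • P) s := h s
      _ = ∫⁻ _ in s, c ∂P := by rw [setLIntegral_const]; rfl
  obtain ⟨K, hK⟩ := (isCompact_Icc (a := (0 : ℝ)) (b := c)).exists_bound_of_continuousOn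
    continuous_klFun.continuousOn
  refine Integrable.of_bound
    (measurable_klFun.comp (Q.measurable_rnDeriv P).ennreal_toReal).aestronglyMeasurable K ?_
  filter_upwards [hbound] with x hx
  exact hK _ ⟨ENNReal.toReal_nonneg, ENNReal.toReal_le_coe_of_le_coe hx⟩

variable {d : ℕ} {S : SampleSpace d} {P : Measure (E d)}

/-- The means of the probability measures with bounded density with respect to `P`. -/
def boundedMeans (P : Measure (E d)) : Set (E d) :=
  {y | ∃ Q : Measure (E d), IsProbabilityMeasure Q ∧ (∃ c : ℝ≥0, Q ≤ c • P) ∧ HasMean Q y}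

theorem convex_boundedMeans (P : Measure (E d)) : Convex ℝ (boundedMeans P) := by
  rintro y₁ ⟨Q₁, hQ₁, ⟨c₁, hc₁⟩, hi₁, hm₁⟩ y₂ ⟨Q₂, hQ₂, ⟨c₂, hc₂⟩, hi₂, hm₂⟩ a b ha hb hab
  lift a to ℝ≥0 using ha
  lift b to ℝ≥0 using hb
  have hab' : a + b = 1 := by exact_mod_cast hab
  have hi₁' : Integrable (fun x : E d => x) (a • Q₁) := hi₁.smul_measure_nnreal
  have hi₂' : Integrable (fun x : E d => x) (b • Q₂) := hi₂.smul_measure_nnreal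
  refine ⟨a • Q₁ + b • Q₂, ⟨?_⟩, ⟨a * c₁ + b * c₂, ?_⟩, hi₁'.add_measure hi₂', ?_⟩
  · simp only [Measure.add_apply, Measure.smul_apply, measure_univ, ENNReal.smul_def, smul_eq_mul,
      mul_one]
    exact_mod_cast hab'
  · rw [add_smul, mul_smul, mul_smul]
    gcongr
  · rw [integral_add_measure hi₁' hi₂', integral_smul_nnreal_measure,
      integral_smul_nnreal_measure, hm₁, hm₂]
    rfl

theorem boundedMeans_subset_effDom (hP : P ∈ S.probMeasures) :
    boundedMeans P ⊆ effDom (mem S P) := by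
  rintro y ⟨Q, hQ, ⟨c, hc⟩, hm⟩
  have := hP.1
  have hac : Q ≪ P := (Measure.absolutelyContinuous_of_le hc).trans
    Measure.smul_absolutelyContinuous
  have hle : mem S P y ≤ klDiv Q P := iInf₂_le Q ⟨⟨hQ, hac.trans hP.2⟩, hm⟩
  exact hle.trans_lt (klDiv_ne_top_of_le_smul hc).lt_top

theorem exists_mean_of_mem_effDom {y : E d} (hy : y ∈ effDom (mem S P)) :
    ∃ Q : Measure (E d), IsProbabilityMeasure Q ∧ Q ≪ S.dominating ∧ Q ≪ P ∧ HasMean Q y := by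
  have hy' : mem S P y < ⊤ := hy
  simp only [mem, iInf_lt_iff] at hy'
  obtain ⟨Q, hQ, hkl⟩ := hy'
  exact ⟨Q, hQ.1.1, hQ.1.2, (klDiv_ne_top_iff.mp hkl.ne).1, hQ.2⟩

/-- Conditioning on a bounded event of positive mass yields a bounded density. -/
theorem exists_mem_boundedMeans [IsFiniteMeasure P] {B C : Set (E d)} (hB : MeasurableSet B)
    (hpos : P B ≠ 0) (hC : Convex ℝ C) (hCb : Bornology.IsBounded C) (hBC : B ⊆ C) :
    ∃ z ∈ boundedMeans P, z ∈ C := by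
  have hQ : IsProbabilityMeasure ((P B)⁻¹ • P.restrict B) :=
    ProbabilityTheory.cond_isProbabilityMeasure hpos
  have hfin : (P B)⁻¹ ≠ ⊤ := ENNReal.inv_ne_top.mpr hpos
  have hae : ∀ᵐ x ∂((P B)⁻¹ • P.restrict B), x ∈ C :=
    Measure.smul_absolutelyContinuous.ae_le
      ((ae_restrict_mem hB).mono fun x hx => hBC hx)
  obtain ⟨K, hK⟩ := hCb.exists_norm_le
  have hint : Integrable (fun x : E d => x) ((P B)⁻¹ • P.restrict B) :=
    Integrable.of_bound aestronglyMeasurable_id K (hae.mono fun x hx => hK x hx)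
  refine ⟨_, ⟨_, hQ, ⟨(P B)⁻¹.toNNReal, ?_⟩, hint, rfl⟩, mean_mem_of_convex hint rfl hC hae⟩
  intro s
  simp only [Measure.smul_apply, smul_eq_mul, ENNReal.smul_def, ENNReal.coe_toNNReal hfin]
  gcongr
  exact Measure.restrict_le_self

theorem ae_mem_supp (hP : P ∈ S.probMeasures) : ∀ᵐ x ∂P, x ∈ S.supp P := by
  have h0 : P (S.carrier \ S.supp P) = 0 := (S.isLeast_supp P).1.2.2
  have hc : ∀ᵐ x ∂P, x ∈ S.carrier := by
    cases S with
    | continuous => exact Eventually.of_forall fun x => mem_univ x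
    | discrete Ω hΩ => exact hP.2.ae_le (ae_restrict_mem hΩ.measurableSet)
  filter_upwards [hc, measure_eq_zero_iff_ae_notMem.mp h0] with x hx hx'
  by_contra h
  exact hx' ⟨hx, h⟩

theorem measure_singleton_ne_zero_of_countable (hP : P ∈ S.probMeasures)
    (hc : (S.supp P).Countable) {x : E d} (hx : x ∈ S.supp P) : P {x} ≠ 0 := by
  cases S with
  | discrete Ω hΩ => exact hx.2.ne'
  | continuous =>
    have := hP.1
    -- For `d = 0` the singleton is the whole space, of mass one. Otherwise countable sets are
    -- Lebesgue null, so the support cannot be countable.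
    rcases subsingleton_or_nontrivial (E d) with hd | hd
    · rw [Set.eq_univ_of_forall fun z => mem_singleton_iff.mpr (Subsingleton.elim z x)]
      simp
    · have h0 : P (SampleSpace.supp .continuous P) = 0 := hP.2 (hc.measure_zero volume)
      have h1 := (ae_mem_supp hP).and (measure_eq_zero_iff_ae_notMem.mp h0)
      obtain ⟨z, hz, hz'⟩ := h1.exists
      exact absurd hz hz'

theorem effDom_mem_of_countable (hP : P ∈ S.probMeasures) (hc : (S.supp P).Countable) :
    effDom (mem S P) = convexHull ℝ (S.supp P) := by
  have := hP.1
  apply Subset.antisymm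
  · intro y hy
    obtain ⟨Q, hQ, -, hQP, hint, hmean⟩ := exists_mean_of_mem_effDom hy
    exact mean_mem_of_convex hint hmean (convex_convexHull ℝ _)
      (hQP.ae_le ((ae_mem_supp hP).mono fun x hx => subset_convexHull ℝ _ hx))
  · refine (convexHull_min (fun x hx => ?_) (convex_boundedMeans P)).trans
      (boundedMeans_subset_effDom hP)
    -- Conditioning on the atom `{x}` gives a measure with mean `x`.
    obtain ⟨z, hz, hzx⟩ := exists_mem_boundedMeans (measurableSet_singleton x)
      (measure_singleton_ne_zero_of_countable hP hc hx) (convex_singleton x)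
      Bornology.isBounded_singleton Subset.rfl
    rwa [← mem_singleton_iff.mp hzx]

theorem effDom_mem_continuous (hP : P ∈ (SampleSpace.continuous (d := d)).probMeasures) :
    effDom (mem .continuous P) = interior (SampleSpace.convexSupport .continuous P) := by
  have := hP.1
  apply Subset.antisymm
  · intro y hy
    obtain ⟨Q, hQ, hQv, hQP, hint, hmean⟩ := exists_mean_of_mem_effDom hy
    exact mean_mem_interior_of_convex (μ := volume) hQv hint hmean (convex_convexHull ℝ _).closure
      (hQP.ae_le ((ae_mem_supp hP).mono fun x hx =>
        subset_closure (subset_convexHull ℝ _ hx)))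
  · have hsub : SampleSpace.convexSupport .continuous P ⊆ closure (boundedMeans P) := by
      refine closure_minimal (convexHull_min (fun x hx => ?_) (convex_boundedMeans P).closure)
        isClosed_closure
      -- Balls around a support point have positive mass, and conditioning on one gives a mean
      -- inside that ball.
      refine Metric.mem_closure_iff.mpr fun ε hε => ?_
      have hpos : P (Metric.ball x ε) ≠ 0 :=
        ((Measure.mem_support_iff_forall x).mp hx _ (Metric.ball_mem_nhds x hε)).ne'
      obtain ⟨z, hz, hzx⟩ := exists_mem_boundedMeans measurableSet_ball hpos
        (convex_ball x ε) Metric.isBounded_ball Subset.rfl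
      exact ⟨z, hz, by rwa [dist_comm]⟩
    exact ((interior_mono hsub).trans
      (interior_closure_subset_of_convex (convex_boundedMeans P))).trans
      (boundedMeans_subset_effDom hP)

end MEM

theorem mainTheorem2 (d : ℕ) (S : MEM.SampleSpace d)
    (P : MeasureTheory.Measure (EuclideanSpace ℝ (Fin d))) (hP : MEM.IsReference S P) :
    ((S.supp P).Countable → MEM.effDom (MEM.mem S P) = convexHull ℝ (S.supp P)) ∧
    ((S.supp P).Finite → MEM.effDom (MEM.mem S P) = S.convexSupport P) ∧
    (¬ (S.supp P).Countable → MEM.effDom (MEM.mem S P) = interior (S.convexSupport P)) := by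
  refine ⟨MEM.effDom_mem_of_countable hP.mem, fun hf => ?_, fun hc => ?_⟩
  · rw [MEM.effDom_mem_of_countable hP.mem hf.countable]
    exact (hf.isClosed_convexHull ℝ).closure_eq.symm
  · cases S with
    | continuous => exact MEM.effDom_mem_continuous hP.mem
    | discrete Ω hΩ => exact absurd (hΩ.mono fun x hx => hx.1) hc
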